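/- An instance of correlation clustering is a complete graph on a finite vertex set $V$ in which every edge is labelled $+$ or $-$. A clustering is a partition of $V$ into nonempty clusters; it makes a mistake on an edge $\{u,v\}$ if the edge is labelled $+$ and $u,v$ lie in different clusters, or is labelled $-$ and $u,v$ lie in the same cluster. Let $OPT$ be a clustering with the minimum number of mistakes, let $C_{OPT}$ be that number, and let an oracle answer, for an edge $\{u,v\}$, whether $OPT$ makes a mistake on it. A $(+,+,-)$ triangle is a triple of distinct vertices with exactly two $+$ edges. For $p\in[0,1]$, the algorithm $\mathrm{RandomQueryPivot}(p)$ works as follows, starting with all of $V$ as the set $R$ of remaining vertices and stopping when $R$ is empty. Pick a pivot $u\in R$ uniformly at random. Go, in any order (which may depend on $R$ and $u$), through all $(+,+,-)$ triangles $\{u,v,w\}\subseteq R$ containing $u$, named so that $\{u,v\}$ is a $+$ edge. Independently for each of them, with probability $1-p$ skip it, and with probability $p$ do the following: query $\{u,v\}$, and if $OPT$ makes a mistake on it, decide to make a mistake on it; then, if $\{u,w\}$ is a $+$ edge or $OPT$ makes no mistake on $\{u,v\}$, also query $\{u,w\}$, and if $OPT$ makes a mistake on it, decide to make a mistake on it.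 The cluster $C$ of $u$ consists of $u$, of the $v\in R\setminus\{u\}$ with $\{u,v\}$ a $+$ edge on which it was not decided to make a mistake, and of the $v\in R\setminus\{u\}$ with $\{u,v\}$ a $-$ edge on which it was decided to make a mistake. Output $C$ and continue with $R\setminus C$. An edge that is queried in several triangles counts as a single query. **Theorem.** For every such instance, every optimal clustering $OPT$ and every $p\in[0,1]$, $\mathrm{RandomQueryPivot}(p)$ always outputs a clustering of $V$, the expected number of mistakes of this clustering is at most $\max\left(2,\frac{3}{1+2p}\right)C_{OPT}$, and the expected number of queries made by the algorithm is at most $\max(4p,1)\,C_{OPT}$. -/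

import Mathlib

open scoped ENNReal

namespace CorrelationClustering

/-! ## Correlation clustering

The complete graph on `V` with edges labelled `+` / `-` is given by the graph `G` of its `+` edges:
a pair of distinct vertices is a `+` edge if it is adjacent in `G`, and a `-` edge otherwise. -/

/-- `P` is a clustering of `V`: a partition of `V` into nonempty clusters. -/
def IsClustering {V : Type*} (P : Finset (Finset V)) : Prop :=
  ∅ ∉ P ∧ ∀ v : V, ∃! C : Finset V, C ∈ P ∧ v ∈ C

/-- Some cluster of `P` contains both `u` and `v`. -/
def SameCluster {V : Type*} (P : Finset (Finset V)) (u v : V) : Prop :=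
  ∃ C ∈ P, u ∈ C ∧ v ∈ C

/-- `P` makes a mistake on the edge `{u, v}`: it is a `+` edge between different clusters
or a `-` edge inside a cluster. -/
def IsMistake {V : Type*} (G : SimpleGraph V) (P : Finset (Finset V)) (u v : V) : Prop :=
  u ≠ v ∧ ((G.Adj u v ∧ ¬ SameCluster P u v) ∨ (¬ G.Adj u v ∧ SameCluster P u v))

instance {V : Type*} [DecidableEq V] (P : Finset (Finset V)) (u v : V) :
    Decidable (SameCluster P u v) := by
  unfold SameCluster; infer_instance

instance {V : Type*} [DecidableEq V] (G : SimpleGraph V) [DecidableRel G.Adj]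
    (P : Finset (Finset V)) (u v : V) : Decidable (IsMistake G P u v) := by
  unfold IsMistake; infer_instance

/-- The number of (unordered) edges on which `P` makes a mistake. -/
def mistakes {V : Type*} [Fintype V] [DecidableEq V] (G : SimpleGraph V) [DecidableRel G.Adj]
    (P : Finset (Finset V)) : ℕ :=
  (Finset.univ.filter fun e : Sym2 V => ∃ u v : V, e = s(u, v) ∧ IsMistake G P u v).card

/-- `P` is an optimal clustering: a clustering with the least number of mistakes. -/
def IsOptimal {V : Type*} [Fintype V] [DecidableEq V] (G : SimpleGraph V) [DecidableRel G.Adj]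
    (P : Finset (Finset V)) : Prop :=
  IsClustering P ∧ ∀ Q : Finset (Finset V), IsClustering Q → mistakes G P ≤ mistakes G Q

/-- The oracle of the clustering `P`: it answers `true` on `(u, v)` iff `P` makes a mistake
on the edge `{u, v}`. -/
def oracleOf {V : Type*} [DecidableEq V] (G : SimpleGraph V) [DecidableRel G.Adj]
    (P : Finset (Finset V)) (u v : V) : Bool :=
  decide (IsMistake G P u v)

/-- `u, v, w` form a `(+, +, -)` triangle: exactly two of its three edges are `+` edges. -/
def IsPPMTriangle {V : Type*} (G : SimpleGraph V) (u v w : V) : Prop :=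
  (u ≠ v ∧ u ≠ w ∧ v ≠ w) ∧
    ((G.Adj u v ∧ G.Adj u w ∧ ¬ G.Adj v w) ∨
     (G.Adj u v ∧ ¬ G.Adj u w ∧ G.Adj v w) ∨
     (¬ G.Adj u v ∧ G.Adj u w ∧ G.Adj v w))

/-- `L` lists, in some order and each exactly once, the `(+, +, -)` triangles `{u, v, w}` that
contain the pivot `u` and whose vertices all belong to `R`. Such a triangle is recorded as a pair
`(v, w)`, named in such a way that `{u, v}` is a `+` edge. -/
def IsTriangleEnum {V : Type*} (G : SimpleGraph V) (R : Finset V) (u : V)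
    (L : List (V × V)) : Prop :=
  (∀ t ∈ L, t.1 ∈ R ∧ t.2 ∈ R ∧ IsPPMTriangle G u t.1 t.2 ∧ G.Adj u t.1) ∧
  (∀ v ∈ R, ∀ w ∈ R, IsPPMTriangle G u v w → (v, w) ∈ L ∨ (w, v) ∈ L) ∧
  (L.map fun t => s(t.1, t.2)).Nodup

/-- Enumerations of the triangles exist. -/
theorem exists_isTriangleEnum {V : Type*} (G : SimpleGraph V) (R : Finset V) (u : V) :
    ∃ L : List (V × V), IsTriangleEnum G R u L := by
  classical
  let S : Finset (Sym2 V) :=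
    ((R ×ˢ R).filter fun t => IsPPMTriangle G u t.1 t.2).image fun t => s(t.1, t.2)
  have hS : ∀ e ∈ S, ∃ t : V × V, s(t.1, t.2) = e ∧
      t.1 ∈ R ∧ t.2 ∈ R ∧ IsPPMTriangle G u t.1 t.2 ∧ G.Adj u t.1 := by
    intro e he
    simp only [S, Finset.mem_image, Finset.mem_filter, Finset.mem_product] at he
    obtain ⟨⟨v, w⟩, ⟨⟨hv, hw⟩, ht⟩, rfl⟩ := he
    by_cases h : G.Adj u v
    · exact ⟨(v, w), rfl, hv, hw, ht, h⟩
    · refine ⟨(w, v), Sym2.eq_swap, hw, hv, ?_, ?_⟩ <;>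
        simp only [IsPPMTriangle, G.adj_comm v w, h] at ht ⊢ <;> tauto
  haveI : Nonempty V := ⟨u⟩
  choose! f hf using hS
  refine ⟨S.toList.map f, ?_, ?_, ?_⟩
  · intro t ht
    obtain ⟨e, he, rfl⟩ := List.mem_map.1 ht
    exact (hf e (Finset.mem_toList.1 he)).2
  · intro v hv w hw ht
    have he : s(v, w) ∈ S := Finset.mem_image.2 ⟨(v, w), by simp [hv, hw, ht], rfl⟩
    have hmem : f s(v, w) ∈ S.toList.map f := List.mem_map.2 ⟨_, Finset.mem_toList.2 he, rfl⟩
    have heq := (hf _ he).1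
    rcases Sym2.eq_iff.1 heq with ⟨h1, h2⟩ | ⟨h1, h2⟩
    · left; rwa [show f s(v, w) = (v, w) from Prod.ext h1 h2] at hmem
    · right; rwa [show f s(v, w) = (w, v) from Prod.ext h1 h2] at hmem
  · rw [List.map_map, List.map_congr_left (g := id), List.map_id]
    · exact S.nodup_toList
    · intro e he
      exact (hf e (Finset.mem_toList.1 he)).1

/-! ## The algorithm -/

/-- A coin that shows `true` with probability `p` and `false` with probability `1 - p`. -/
noncomputable def coin (p : unitInterval) : PMF Bool :=
  PMF.ofFintype
    (fun b => if b = true then ENNReal.ofReal (p : ℝ) else ENNReal.ofReal (1 - (p : ℝ)))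
    (by
      have h0 : (0 : ℝ) ≤ p := p.2.1
      have h1 : (0 : ℝ) ≤ 1 - p := sub_nonneg.2 p.2.2
      simp [← ENNReal.ofReal_add h0 h1])

/-- The memory of one iteration, with pivot `u`: `queried` holds the vertices `v` for which
`{u, v}` has been queried, `mistake` those for which it was decided to make a mistake
on `{u, v}`. -/
structure IterState (V : Type*) where
  queried : Finset V
  mistake : Finset V

/-- Query the edge `{u, v}`, and decide to make a mistake on it if the answer says so. As `queried`
is a set, an edge that comes up in several triangles is counted as one query. -/
def ask {V : Type*} [DecidableEq V] (oracle : V → V → Bool) (u v : V) (s : IterState V) :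
    IterState V where
  queried := insert v s.queried
  mistake := if oracle u v = true then insert v s.mistake else s.mistake

/-- Processing of the triangle `{u, v, w}`, where `u` is the pivot and `{u, v}` is a `+` edge:
query `{u, v}`; then query `{u, w}` too if no mistake is made on `{u, v}`, or if
`{u, w}` is a `+` edge. -/
def processTriangle {V : Type*} [DecidableEq V] (G : SimpleGraph V) [DecidableRel G.Adj]
    (oracle : V → V → Bool) (u v w : V) (s : IterState V) : IterState V :=
  let s' := ask oracle u v s
  if v ∉ s'.mistake ∨ G.Adj u w then ask oracle u w s' else s'

/-- The loop over the list of triangles: each triangle is processed with probability `p` and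
skipped with probability `1 - p`, by independent coin flips. -/
noncomputable def triangleLoop {V : Type*} [DecidableEq V] (G : SimpleGraph V)
    [DecidableRel G.Adj] (oracle : V → V → Bool) (p : unitInterval) (u : V) :
    List (V × V) → IterState V → PMF (IterState V)
  | [], s => PMF.pure s
  | t :: L, s => (coin p).bind fun b =>
      triangleLoop G oracle p u L
        (if b = true then processTriangle G oracle u t.1 t.2 s else s)

/-- The cluster of the pivot `u` among the remaining vertices `R`: from `R` one removes the
`-` neighbours of `u` on which no mistake is made and the `+` neighbours on which one is made. -/
def pivotCluster {V : Type*} [DecidableEq V] (G : SimpleGraph V) [DecidableRel G.Adj]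
    (R : Finset V) (u : V) (mistake : Finset V) : Finset V :=
  R.filter fun v => v = u ∨ ¬ ((¬ G.Adj u v ∧ v ∉ mistake) ∨ (G.Adj u v ∧ v ∈ mistake))

theorem card_sdiff_pivotCluster_lt {V : Type*} [DecidableEq V] (G : SimpleGraph V)
    [DecidableRel G.Adj] (R : Finset V) (u : V) (hu : u ∈ R) (mistake : Finset V) :
    (R \ pivotCluster G R u mistake).card < R.card := by
  apply Finset.card_lt_card
  refine ⟨Finset.sdiff_subset, fun h => ?_⟩
  have := h hu
  simp [pivotCluster, hu] at this

/-- The joint distribution of the family of clusters returned by the algorithm on the remaining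
vertices `R` and of the set of edges that it queries. The list `T R u` is the one over which
the algorithm loops when the remaining vertices are `R` and the pivot is `u`. -/
noncomputable def randomQueryPivot {V : Type*} [DecidableEq V] (G : SimpleGraph V)
    [DecidableRel G.Adj] (T : Finset V → V → List (V × V)) (oracle : V → V → Bool)
    (p : unitInterval) (R : Finset V) : PMF (Finset (Finset V) × Finset (Sym2 V)) :=
  if h : R.Nonempty then
    haveI : Nonempty R := h.to_subtype
    (PMF.uniformOfFintype R).bind fun u =>
      (triangleLoop G oracle p u.1 (T R u.1) ⟨∅, ∅⟩).bind fun s =>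
        (randomQueryPivot G T oracle p (R \ pivotCluster G R u.1 s.mistake)).map fun out =>
          (insert (pivotCluster G R u.1 s.mistake) out.1,
            (s.queried.image fun v => s(u.1, v)) ∪ out.2)
  else PMF.pure (∅, ∅)
termination_by R.card
decreasing_by exact card_sdiff_pivotCluster_lt G R u.1 u.2 s.mistake

/-- The expectation of a function with values in the natural numbers. -/
noncomputable def expectation {α : Type*} (μ : PMF α) (f : α → ℕ) : ℝ≥0∞ :=
  ∑' a, μ a * (f a : ℝ≥0∞)

end CorrelationClustering

/-! The proof compares, in one iteration with remaining vertices `R`, the mistakes made by the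
algorithm with the mistakes of `OPT` that are decided, that is, that lie on edges meeting the removed
cluster. If, for a uniformly random pivot, the former are in expectation at most `c` times the
latter, then induction over the iterations (`mean_randomQueryPivot_le`) bounds the total expected
number of mistakes by `c` times that of `OPT`, since every edge is decided exactly once. The queries
are treated in the same way.

For a pivot `u`, a decision at `u` either follows the label or, on a discovered mistake, follows
`OPT`. A mistake `{u, v}` of `OPT` stays undiscovered with probability `(1 - p) ^ k`, where `k` is the
number of triangles that query it (`loopExp_notMem_mistake`). The edges at the pivot cost at most the
mistakes of `OPT` on them. For an edge `{v, w}` opposite to the pivot (`algProb_le`):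

* if `OPT` makes a mistake on `{v, w}`, this mistake is decided whenever the algorithm makes one;
* if `{u, v}` and `{u, w}` are mistakes and `{v, w}` is not, the mistakes decided with the pivots `v`
  and `w` pay; for `+` edges this uses that a mistake is missed with the same probability from
  both ends (`missProb_comm`);
* if `{u, v}` is the only mistake, the triangle must be a `(+, +, -)` triangle on which `{u, v}` is
  missed.

So every decided mistake is charged at most twice, except for the last case. There, an edge that is
the only mistake on `n` triangles has cost `n` from the opposite pivots, twice `n * (1 - p) ^ n` from
its ends, and `2 * (1 - (1 - p) ^ n)` for itself, against `n + 2` decided mistakes; this reduces to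
`2 * (n - 1) * (1 - p) ^ n ≤ (c - 1) * (n + 2)` (`pow_mul_le`, `edge_charge_le`).

A query is either a mistake of `OPT` at the pivot, or is made in a triangle with exactly one mistake.
Such a triangle leads to at most four queries of correct edges, each with probability at most
`p`, and its mistake is decided by the opposite pivot (`sum_queried_le`). -/

namespace CorrelationClustering

/-! ### Expectations -/

/-- The expectation of a function with values in `ℝ≥0∞`. -/
noncomputable def mean {α : Type*} (μ : PMF α) (f : α → ℝ≥0∞) : ℝ≥0∞ := ∑' a, μ a * f a

theorem mean_pure {α : Type*} (a : α) (f : α → ℝ≥0∞) : mean (PMF.pure a) f = f a := by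
  rw [mean, tsum_eq_single a]
  · simp
  · intro b hb
    simp [PMF.pure_apply, hb]

theorem mean_bind {α β : Type*} (μ : PMF α) (κ : α → PMF β) (f : β → ℝ≥0∞) :
    mean (μ.bind κ) f = mean μ fun a => mean (κ a) f := by
  simp only [mean, PMF.bind_apply, ← ENNReal.tsum_mul_right, ← ENNReal.tsum_mul_left]
  rw [ENNReal.tsum_comm]
  simp only [mul_assoc]

theorem mean_map {α β : Type*} (μ : PMF α) (g : α → β) (f : β → ℝ≥0∞) :
    mean (μ.map g) f = mean μ fun a => f (g a) := by
  rw [← PMF.bind_pure_comp, mean_bind]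
  simp only [Function.comp, mean_pure]

theorem mean_mono {α : Type*} {μ : PMF α} {f g : α → ℝ≥0∞} (h : ∀ a ∈ μ.support, f a ≤ g a) :
    mean μ f ≤ mean μ g := by
  refine ENNReal.tsum_le_tsum fun a => ?_
  by_cases ha : μ a = 0
  · simp [ha]
  · exact mul_le_mul_right (h a ((PMF.mem_support_iff μ a).2 ha)) _

theorem mean_const_add {α : Type*} (μ : PMF α) (c : ℝ≥0∞) (f : α → ℝ≥0∞) :
    mean μ (fun a => c + f a) = c + mean μ f := by
  simp only [mean, mul_add, ENNReal.tsum_add, ENNReal.tsum_mul_right, PMF.tsum_coe, one_mul]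

theorem expectation_eq_mean {α : Type*} (μ : PMF α) (f : α → ℕ) :
    expectation μ f = mean μ fun a => (f a : ℝ≥0∞) := rfl

theorem mean_coin (p : unitInterval) (f : Bool → ℝ≥0∞) :
    mean (coin p) f =
      ENNReal.ofReal (p : ℝ) * f true + ENNReal.ofReal (1 - (p : ℝ)) * f false := by
  simp [mean, coin]

theorem mean_uniformOfFintype {V : Type*} (R : Finset V) [Nonempty R] (f : V → ℝ≥0∞) :
    mean (PMF.uniformOfFintype R) (fun u => f u) = (R.card : ℝ≥0∞)⁻¹ * ∑ u ∈ R, f u := by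
  rw [mean, tsum_fintype, Finset.mul_sum, ← Finset.sum_coe_sort R]
  simp

open Classical in
/-- The indicator of a proposition. -/
noncomputable def ind (q : Prop) : ℝ := if q then 1 else 0

theorem ind_true {q : Prop} (h : q) : ind q = 1 := if_pos h

theorem ind_false {q : Prop} (h : ¬ q) : ind q = 0 := if_neg h

theorem ind_nonneg (q : Prop) : 0 ≤ ind q := by
  unfold ind; split_ifs <;> norm_num

theorem ind_le_one (q : Prop) : ind q ≤ 1 := by
  unfold ind; split_ifs <;> norm_num

theorem ind_mono {q r : Prop} (h : q → r) : ind q ≤ ind r := by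
  by_cases hq : q
  · rw [ind_true hq, ind_true (h hq)]
  · rw [ind_false hq]; exact ind_nonneg r

theorem ind_congr {q r : Prop} (h : q ↔ r) : ind q = ind r := by
  rw [propext h]

theorem sum_ind {α : Type*} (S : Finset α) (q : α → Prop) [DecidablePred q] :
    ∑ x ∈ S, ind (q x) = ((S.filter q).card : ℝ) := by
  rw [← Finset.sum_boole]
  refine Finset.sum_congr rfl fun x _ => ?_
  by_cases h : q x <;> simp [ind, h]

/-! ### The loop over the triangles -/

/-- The state is consistent: the decided mistakes are the queried vertices on which the oracle
reports a mistake. -/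
def IterState.Consistent {V : Type*} (oracle : V → V → Bool) (u : V) (s : IterState V) : Prop :=
  ∀ v, v ∈ s.mistake ↔ v ∈ s.queried ∧ oracle u v = true

theorem consistent_empty {V : Type*} {oracle : V → V → Bool} (u : V) :
    IterState.Consistent oracle u ⟨∅, ∅⟩ := by
  intro v; simp

section Loop

variable {V : Type*} [DecidableEq V] (G : SimpleGraph V) [DecidableRel G.Adj]
  (oracle : V → V → Bool)

/-- The expectation of a real function of the final state of the loop over a list of triangles,
computed by recursion on the list. -/
noncomputable def loopExp (p : unitInterval) (u : V) :
    List (V × V) → IterState V → (IterState V → ℝ) → ℝ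
  | [], s, f => f s
  | t :: L, s, f => p * loopExp p u L (processTriangle G oracle u t.1 t.2 s) f +
      (1 - p) * loopExp p u L s f

/-- Processing the triangle `t` with pivot `u` queries the edge `{u, x}`. -/
def Asks (u : V) (t : V × V) (x : V) : Prop :=
  x = t.1 ∨ (x = t.2 ∧ (oracle u t.1 = false ∨ G.Adj u t.2))

variable {G oracle}

theorem consistent_ask {u v : V} {s : IterState V} (hs : s.Consistent oracle u) :
    (ask oracle u v s).Consistent oracle u := by
  intro x
  have := hs x
  by_cases hv : oracle u v = true
  · by_cases hx : x = v <;> simp_all [ask]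
  · by_cases hx : x = v <;> simp_all [ask]

theorem consistent_processTriangle {u v w : V} {s : IterState V} (hs : s.Consistent oracle u) :
    (processTriangle G oracle u v w s).Consistent oracle u := by
  unfold processTriangle
  dsimp only
  split_ifs
  · exact consistent_ask (consistent_ask hs)
  · exact consistent_ask hs

/-- On a consistent state the test `v ∉ s'.mistake` of `processTriangle` depends on the answer of the
oracle only, so the queries do not depend on the order of the triangles. -/
theorem mem_queried_processTriangle {u : V} {t : V × V} {s : IterState V}
    (hs : s.Consistent oracle u) (x : V) :
    x ∈ (processTriangle G oracle u t.1 t.2 s).queried ↔ x ∈ s.queried ∨ Asks G oracle u t x := by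
  have h : t.1 ∉ (ask oracle u t.1 s).mistake ↔ oracle u t.1 = false := by
    rw [consistent_ask hs t.1]
    simp [ask]
  simp only [processTriangle, h, Asks]
  split_ifs with h1 <;> simp only [ask, Finset.mem_insert] <;> tauto

variable {p : unitInterval} {u : V} {L : List (V × V)} {s : IterState V}

theorem loopExp_mono {f g : IterState V → ℝ} (hs : s.Consistent oracle u)
    (h : ∀ s', s'.Consistent oracle u → f s' ≤ g s') :
    loopExp G oracle p u L s f ≤ loopExp G oracle p u L s g := by
  induction L generalizing s with
  | nil => exact h s hs
  | cons t L ih =>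
    simp only [loopExp]
    have := mul_le_mul_of_nonneg_left (ih (consistent_processTriangle (G := G) (v := t.1)
      (w := t.2) hs)) p.2.1
    have := mul_le_mul_of_nonneg_left (ih hs) (sub_nonneg.2 p.2.2)
    linarith

theorem loopExp_const (c : ℝ) : loopExp G oracle p u L s (fun _ => c) = c := by
  induction L generalizing s with
  | nil => rfl
  | cons t L ih => simp only [loopExp, ih]; ring

theorem loopExp_add (f g : IterState V → ℝ) :
    loopExp G oracle p u L s (fun x => f x + g x) =
      loopExp G oracle p u L s f + loopExp G oracle p u L s g := by
  induction L generalizing s with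
  | nil => rfl
  | cons t L ih => simp only [loopExp, ih]; ring

theorem loopExp_const_mul (c : ℝ) (f : IterState V → ℝ) :
    loopExp G oracle p u L s (fun x => c * f x) = c * loopExp G oracle p u L s f := by
  induction L generalizing s with
  | nil => rfl
  | cons t L ih => simp only [loopExp, ih]; ring

theorem loopExp_sum {ι : Type*} (S : Finset ι) (f : ι → IterState V → ℝ) :
    loopExp G oracle p u L s (fun x => ∑ i ∈ S, f i x) =
      ∑ i ∈ S, loopExp G oracle p u L s (f i) := by
  induction L generalizing s with
  | nil => rfl
  | cons t L ih => simp only [loopExp, ih, Finset.mul_sum, Finset.sum_add_distrib]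

theorem loopExp_nonneg {f : IterState V → ℝ} (h : ∀ s', 0 ≤ f s') :
    0 ≤ loopExp G oracle p u L s f := by
  induction L generalizing s with
  | nil => exact h s
  | cons t L ih => exact add_nonneg (mul_nonneg p.2.1 ih) (mul_nonneg (sub_nonneg.2 p.2.2) ih)

/-- `loopExp` is the expectation over the loop. -/
theorem mean_triangleLoop {f : IterState V → ℝ} (hf : ∀ s', 0 ≤ f s') :
    mean (triangleLoop G oracle p u L s) (fun s' => ENNReal.ofReal (f s')) =
      ENNReal.ofReal (loopExp G oracle p u L s f) := by
  induction L generalizing s with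
  | nil => simp only [triangleLoop, loopExp, mean_pure]
  | cons t L ih =>
    have hp := p.2.1
    have hq := sub_nonneg.2 p.2.2
    simp only [triangleLoop, loopExp, mean_bind, mean_coin, ih, if_true, Bool.false_eq_true,
      if_false]
    rw [ENNReal.ofReal_add (mul_nonneg hp (loopExp_nonneg hf)) (mul_nonneg hq (loopExp_nonneg hf)),
      ENNReal.ofReal_mul hp, ENNReal.ofReal_mul hq]

open Classical in
/-- The triangles that ask for an edge on which the oracle reports a mistake are sampled
independently, so that all of them are missed with probability `(1 - p) ^ k`. -/
theorem loopExp_notMem_mistake {x : V} (hx : oracle u x = true) (hs : s.Consistent oracle u) :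
    loopExp G oracle p u L s (fun s' => ind (x ∉ s'.mistake)) =
      ind (x ∉ s.mistake) * (1 - (p : ℝ)) ^ L.countP (fun t => Asks G oracle u t x) := by
  induction L generalizing s with
  | nil => simp [loopExp]
  | cons t L ih =>
    have hs' := consistent_processTriangle (G := G) (v := t.1) (w := t.2) hs
    simp only [loopExp]
    rw [ih hs', ih hs, List.countP_cons]
    have hmem := mem_queried_processTriangle (G := G) (t := t) hs x
    have h1 : x ∈ (processTriangle G oracle u t.1 t.2 s).mistake ↔
        x ∈ s.mistake ∨ Asks G oracle u t x := by
      rw [hs' x, hs x, hmem]; tauto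
    by_cases ht : Asks G oracle u t x
    · rw [ind_false (q := x ∉ (processTriangle G oracle u t.1 t.2 s).mistake)
        (by rw [h1]; tauto)]
      simp only [ht, decide_true, if_true, pow_succ]
      ring
    · rw [ind_congr (q := x ∉ (processTriangle G oracle u t.1 t.2 s).mistake)
        (r := x ∉ s.mistake) (by rw [h1]; tauto)]
      simp only [ht, decide_false, Bool.false_eq_true, if_false, add_zero]
      ring

open Classical in
theorem loopExp_mem_queried_le (x : V) (hs : s.Consistent oracle u) :
    loopExp G oracle p u L s (fun s' => ind (x ∈ s'.queried)) ≤
      ind (x ∈ s.queried) + p * L.countP (fun t => Asks G oracle u t x) := by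
  induction L generalizing s with
  | nil => simp [loopExp]
  | cons t L ih =>
    have hs' := consistent_processTriangle (G := G) (v := t.1) (w := t.2) hs
    have hp := p.2.1
    have hq := sub_nonneg.2 p.2.2
    have e1 := mul_le_mul_of_nonneg_left (ih hs') hp
    have e2 := mul_le_mul_of_nonneg_left (ih hs) hq
    have hmem := mem_queried_processTriangle (G := G) (t := t) hs x
    simp only [loopExp]
    rw [List.countP_cons]
    by_cases ht : Asks G oracle u t x
    · have e3 := mul_le_mul_of_nonneg_left
        (ind_le_one (x ∈ (processTriangle G oracle u t.1 t.2 s).queried)) hp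
      have e4 := mul_nonneg hp (ind_nonneg (x ∈ s.queried))
      simp only [ht, decide_true, if_true]
      push_cast
      linarith
    · rw [ind_congr (r := x ∈ s.queried) (by rw [hmem]; tauto)] at e1
      simp only [ht, decide_false, Bool.false_eq_true, if_false, add_zero]
      linarith

end Loop

/-! ### Mistakes of a clustering -/

section Clustering

variable {V : Type*} {G : SimpleGraph V} {P : Finset (Finset V)}

theorem SameCluster.symm {u v : V} (h : SameCluster P u v) : SameCluster P v u := by
  obtain ⟨C, hC, hu, hv⟩ := h
  exact ⟨C, hC, hv, hu⟩

theorem SameCluster.trans (hP : IsClustering P) {u v w : V} (h : SameCluster P u v)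
    (h' : SameCluster P v w) : SameCluster P u w := by
  obtain ⟨C, hC, hu, hv⟩ := h
  obtain ⟨D, hD, hv', hw⟩ := h'
  obtain rfl := (hP.2 v).unique ⟨hC, hv⟩ ⟨hD, hv'⟩
  exact ⟨C, hC, hu, hw⟩

theorem IsMistake.symm {u v : V} (h : IsMistake G P u v) : IsMistake G P v u := by
  refine ⟨h.1.symm, ?_⟩
  rw [G.adj_comm v u, show SameCluster P v u ↔ SameCluster P u v from
    ⟨SameCluster.symm, SameCluster.symm⟩]
  exact h.2

theorem isMistake_comm {u v : V} : IsMistake G P u v ↔ IsMistake G P v u :=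
  ⟨IsMistake.symm, IsMistake.symm⟩

theorem isMistake_iff {u v : V} (h : u ≠ v) :
    IsMistake G P u v ↔ ¬ (G.Adj u v ↔ SameCluster P u v) := by
  unfold IsMistake
  tauto

theorem isPPMTriangle_swap {u v w : V} : IsPPMTriangle G u v w ↔ IsPPMTriangle G u w v := by
  unfold IsPPMTriangle
  rw [G.adj_comm v w]
  tauto

theorem isPPMTriangle_rotate {u v w : V} : IsPPMTriangle G u v w ↔ IsPPMTriangle G v u w := by
  unfold IsPPMTriangle
  rw [G.adj_comm u v]
  tauto

variable (G P)

/-- The triangle `{u, v, w}` is a `(+, +, -)` triangle and `{u, v}` is the only one of its edges on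
which `P` makes a mistake. -/
def OnlyMistake (u v w : V) : Prop :=
  IsPPMTriangle G u v w ∧ IsMistake G P u v ∧ ¬ IsMistake G P u w ∧ ¬ IsMistake G P v w

/-- In the triangle `{u, v, w}` the clustering `P` makes mistakes on the two edges at `u`, and not
on the edge `{v, w}`. -/
def TwoMistakes (u v w : V) : Prop :=
  v ≠ w ∧ IsMistake G P u v ∧ IsMistake G P u w ∧ ¬ IsMistake G P v w

variable {G P}

theorem IsPPMTriangle.exists_isMistake (hP : IsClustering P) {u v w : V}
    (ht : IsPPMTriangle G u v w) :
    IsMistake G P u v ∨ IsMistake G P u w ∨ IsMistake G P v w := by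
  have h1 : SameCluster P u v → SameCluster P v w → SameCluster P u w := .trans hP
  have h2 : SameCluster P u v → SameCluster P u w → SameCluster P v w := fun h => h.symm.trans hP
  have h3 : SameCluster P u w → SameCluster P v w → SameCluster P u v :=
    fun h h' => h.trans hP h'.symm
  obtain ⟨⟨n1, n2, n3⟩, ht⟩ := ht
  rw [isMistake_iff n1, isMistake_iff n2, isMistake_iff n3]
  by_cases a1 : G.Adj u v <;> by_cases a2 : G.Adj u w <;> by_cases a3 : G.Adj v w <;>
    simp_all <;> tauto

/-- On a `(+, +, -)` triangle with a correct edge `{u, v}`, there is one mistake, unless `{u, v}`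
is its `-` edge and `{u, w}` is a mistake. -/
theorem OnlyMistake.of_asks (hP : IsClustering P) {u v w : V} (ht : IsPPMTriangle G u v w)
    (hq : G.Adj u v ∨ ¬ IsMistake G P u w) (hv : ¬ IsMistake G P u v) :
    OnlyMistake G P u w v ∨ OnlyMistake G P v w u := by
  have h1 : SameCluster P u v → SameCluster P v w → SameCluster P u w := .trans hP
  have h2 : SameCluster P u v → SameCluster P u w → SameCluster P v w := fun h => h.symm.trans hP
  have h3 : SameCluster P u w → SameCluster P v w → SameCluster P u v :=
    fun h h' => h.trans hP h'.symm
  have e1 := isMistake_comm (G := G) (P := P) (u := v) (v := u)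
  have e2 := isMistake_comm (G := G) (P := P) (u := w) (v := v)
  have e3 := isMistake_comm (G := G) (P := P) (u := w) (v := u)
  have t1 := isPPMTriangle_swap.1 ht
  have t2 := isPPMTriangle_swap.1 (isPPMTriangle_rotate.1 ht)
  unfold OnlyMistake
  rw [e1, e2, e3]
  obtain ⟨⟨n1, n2, n3⟩, ht⟩ := ht
  have hn := (isMistake_iff n1).not.1 hv
  simp only [isMistake_iff n2, isMistake_iff n3] at *
  by_cases a1 : G.Adj u v <;> by_cases a2 : G.Adj u w <;> by_cases a3 : G.Adj v w <;>
    simp_all <;> tauto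

end Clustering

/-! ### The triangles that query an edge -/

section Count

variable {V : Type*} [DecidableEq V] (G : SimpleGraph V) [DecidableRel G.Adj]
  (P : Finset (Finset V)) (R : Finset V)

open Classical in
/-- The number of `(+, +, -)` triangles in `R` whose processing with pivot `u` queries the edge
`{u, v}`. -/
noncomputable def askCount (u v : V) : ℕ :=
  (R.filter fun w => IsPPMTriangle G u v w ∧ (G.Adj u v ∨ ¬ IsMistake G P u w)).card

variable {G P R}

theorem oracleOf_eq_true {u v : V} : oracleOf G P u v = true ↔ IsMistake G P u v := by
  simp [oracleOf]

open Classical in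
/-- The number of listed triangles that query `{u, v}` does not depend on the list: a triangle is
determined by its third vertex and is listed once, under one of its two names. -/
theorem countP_asks {u v : V} {L : List (V × V)} (hL : IsTriangleEnum G R u L) (hv : v ∈ R) :
    L.countP (fun t => Asks G (oracleOf G P) u t v) = askCount G P R u v := by
  have hnd : ((L.filter fun t => Asks G (oracleOf G P) u t v).map
      fun t => s(t.1, t.2)).Nodup := hL.2.2.sublist (List.filter_sublist.map _)
  rw [List.countP_eq_length_filter, ← List.length_map (f := fun t : V × V => s(t.1, t.2)),
    ← List.toFinset_card_of_nodup hnd, askCount,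
    ← Finset.card_image_of_injective _ (f := fun w => s(v, w)) (fun a b h => by grind)]
  congr 1
  have hor : ∀ x, oracleOf G P u x = false ↔ ¬ IsMistake G P u x := fun x => by
    rw [← oracleOf_eq_true (G := G)]; simp
  ext e
  simp only [List.mem_toFinset, List.mem_map, List.mem_filter, decide_eq_true_eq,
    Finset.mem_image, Finset.mem_filter]
  constructor
  · rintro ⟨⟨a, b⟩, ⟨hab, hA⟩, rfl⟩
    obtain ⟨ha, hb, ht, hadj⟩ := hL.1 _ hab
    rcases hA with h | ⟨h, h'⟩
    · dsimp only at *
      subst h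
      exact ⟨b, ⟨hb, ht, Or.inl hadj⟩, rfl⟩
    · dsimp only at *
      subst h
      rw [hor] at h'
      exact ⟨a, ⟨ha, isPPMTriangle_swap.1 ht, h'.symm⟩, Sym2.eq_swap⟩
  · rintro ⟨w, ⟨hw, ht, hq⟩, rfl⟩
    rcases hL.2.1 v hv w hw ht with h | h
    · exact ⟨(v, w), ⟨h, Or.inl rfl⟩, rfl⟩
    · refine ⟨(w, v), ⟨h, Or.inr ⟨rfl, ?_⟩⟩, Sym2.eq_swap⟩
      rw [hor]
      exact hq.symm

/-- All triangles on a `+` edge query it, from either end. -/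
theorem askCount_comm {u v : V} (h : G.Adj u v) : askCount G P R u v = askCount G P R v u := by
  unfold askCount
  congr 1
  ext w
  simp [h, h.symm, isPPMTriangle_rotate (u := u)]

end Count

/-! ### One iteration -/

section Cluster

variable {V : Type*} (G : SimpleGraph V) (P : Finset (Finset V))

/-- The output of the cluster `C` makes a mistake on `{v, w}`: a `+` edge with exactly one end in `C`,
or a `-` edge inside `C`. -/
def ClusterMistake (C : Finset V) (v w : V) : Prop :=
  v ≠ w ∧ (v ∈ C ∨ w ∈ C) ∧ (G.Adj v w ↔ ¬ (v ∈ C ∧ w ∈ C))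

/-- The edge `{v, w}` is decided by the output of the cluster `C`, and `P` makes a mistake on it. -/
def DecidedMistake (C : Finset V) (v w : V) : Prop :=
  (v ∈ C ∨ w ∈ C) ∧ IsMistake G P v w

variable {G}

theorem clusterMistake_swap {C : Finset V} {v w : V} :
    ClusterMistake G C v w ↔ ClusterMistake G C w v := by
  unfold ClusterMistake
  rw [G.adj_comm v w]
  tauto

end Cluster

section Round

variable {V : Type*} [DecidableEq V] (G : SimpleGraph V) [DecidableRel G.Adj]
  (P : Finset (Finset V)) (L : V → List (V × V)) (p : unitInterval) (R : Finset V)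

/-- The expectation of a function of the final state of an iteration with pivot `u`. -/
noncomputable def roundExp (u : V) (f : IterState V → ℝ) : ℝ :=
  loopExp G (oracleOf G P) p u (L u) ⟨∅, ∅⟩ f

/-- The probability that the iteration with pivot `u` makes a mistake on `{v, w}`. -/
noncomputable def algProb (u v w : V) : ℝ :=
  roundExp G P L p u fun s => ind (ClusterMistake G (pivotCluster G R u s.mistake) v w)

/-- The probability that the iteration with pivot `u` decides `{v, w}` and that `P` makes a mistake
on this edge. -/
noncomputable def optProb (u v w : V) : ℝ :=
  roundExp G P L p u fun s => ind (DecidedMistake G P (pivotCluster G R u s.mistake) v w)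

/-- The probability that a mistake `{u, v}` of `P` is not discovered with pivot `u`. -/
noncomputable def missProb (u v : V) : ℝ := (1 - (p : ℝ)) ^ askCount G P R u v

variable {G P L p R}

theorem mem_pivotCluster {u x : V} (hx : x ∈ R) (hxu : x ≠ u) (M : Finset V) :
    x ∈ pivotCluster G R u M ↔ (G.Adj u x ↔ x ∉ M) := by
  simp only [pivotCluster, Finset.mem_filter, hx, hxu]
  tauto

theorem self_mem_pivotCluster {u : V} (hu : u ∈ R) (M : Finset V) : u ∈ pivotCluster G R u M := by
  simp [pivotCluster, hu]

theorem roundExp_mono {u : V} {f g : IterState V → ℝ}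
    (h : ∀ s, (∀ x ∈ s.mistake, IsMistake G P u x) → f s ≤ g s) :
    roundExp G P L p u f ≤ roundExp G P L p u g :=
  loopExp_mono (consistent_empty u) fun s hs =>
    h s fun x hx => oracleOf_eq_true.1 ((hs x).1 hx).2

theorem roundExp_notMem {u x : V} (hL : IsTriangleEnum G R u (L u)) (hx : x ∈ R)
    (hm : IsMistake G P u x) :
    roundExp G P L p u (fun s => ind (x ∉ s.mistake)) = missProb G P p R u x := by
  classical
  rw [roundExp, loopExp_notMem_mistake (oracleOf_eq_true.2 hm) (consistent_empty u),
    countP_asks hL hx, ind_true (by simp), one_mul, missProb]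

theorem roundExp_mem {u x : V} (hL : IsTriangleEnum G R u (L u)) (hx : x ∈ R)
    (hm : IsMistake G P u x) :
    roundExp G P L p u (fun s => ind (x ∈ s.mistake)) = 1 - missProb G P p R u x := by
  have h : roundExp G P L p u (fun s => ind (x ∈ s.mistake) + ind (x ∉ s.mistake)) = 1 := by
    rw [show (fun s : IterState V => ind (x ∈ s.mistake) + ind (x ∉ s.mistake)) = fun _ => 1 from
      funext fun s => by by_cases h : x ∈ s.mistake <;> simp [ind, h]]
    exact loopExp_const 1
  rw [← roundExp_notMem hL hx hm, ← h, roundExp, roundExp, roundExp, loopExp_add]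
  ring

theorem roundExp_le {u : V} {f : IterState V → ℝ} {c : ℝ}
    (h : ∀ s, (∀ x ∈ s.mistake, IsMistake G P u x) → f s ≤ c) : roundExp G P L p u f ≤ c :=
  (roundExp_mono h).trans_eq (loopExp_const c)

theorem le_roundExp {u : V} {f : IterState V → ℝ} {c : ℝ}
    (h : ∀ s, (∀ x ∈ s.mistake, IsMistake G P u x) → c ≤ f s) : c ≤ roundExp G P L p u f :=
  (loopExp_const c).symm.trans_le (roundExp_mono h)

theorem roundExp_nonneg {u : V} {f : IterState V → ℝ} (h : ∀ s, 0 ≤ f s) :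
    0 ≤ roundExp G P L p u f :=
  loopExp_nonneg h

theorem missProb_nonneg (u v : V) : 0 ≤ missProb G P p R u v :=
  pow_nonneg (sub_nonneg.2 p.2.2) _

theorem missProb_le_one (u v : V) : missProb G P p R u v ≤ 1 :=
  pow_le_one₀ (sub_nonneg.2 p.2.2) (sub_le_self 1 p.2.1)

theorem missProb_comm {u v : V} (h : G.Adj u v) :
    missProb G P p R u v = missProb G P p R v u := by
  rw [missProb, missProb, askCount_comm h]

theorem optProb_nonneg (u v w : V) : 0 ≤ optProb G P L p R u v w :=
  roundExp_nonneg fun _ => ind_nonneg _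

theorem algProb_swap (u v w : V) : algProb G P L p R u v w = algProb G P L p R u w v := by
  simp only [algProb, clusterMistake_swap (v := v)]

theorem optProb_swap (u v w : V) : optProb G P L p R u v w = optProb G P L p R u w v := by
  simp only [optProb, DecidedMistake, isMistake_comm (u := v), or_comm]

theorem algProb_self_nonpos (u v : V) : algProb G P L p R u v v ≤ 0 :=
  roundExp_le fun s _ => by rw [ind_false]; simp [ClusterMistake]

theorem algProb_le_optProb {u v w : V} (h : IsMistake G P v w) :
    algProb G P L p R u v w ≤ optProb G P L p R u v w :=
  roundExp_mono fun _ _ => ind_mono fun hc => ⟨hc.2.1, h⟩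

theorem algProb_le_one (u v w : V) : algProb G P L p R u v w ≤ 1 :=
  roundExp_le fun _ _ => ind_le_one _

/-- The probability of a mistake on an edge at the pivot. -/
theorem algProb_pivot {u w : V} (hL : IsTriangleEnum G R u (L u)) (hu : u ∈ R) (hw : w ∈ R)
    (huw : u ≠ w) :
    algProb G P L p R u u w ≤ ind (IsMistake G P u w) * (1 - missProb G P p R u w) := by
  have key : ∀ s : IterState V, ClusterMistake G (pivotCluster G R u s.mistake) u w →
      w ∈ s.mistake := by
    intro s h
    unfold ClusterMistake at h
    rw [mem_pivotCluster hw huw.symm] at h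
    have := self_mem_pivotCluster (G := G) hu s.mistake
    tauto
  by_cases hm : IsMistake G P u w
  · rw [ind_true hm, one_mul, ← roundExp_mem hL hw hm]
    exact roundExp_mono fun s _ => ind_mono (key s)
  · rw [ind_false hm, zero_mul]
    exact roundExp_le fun s hs => (ind_false fun h => hm (hs w (key s h))).le

theorem optProb_pivot {u : V} (hu : u ∈ R) (w : V) :
    ind (IsMistake G P u w) ≤ optProb G P L p R u u w :=
  le_roundExp fun _ _ => ind_mono fun h => ⟨Or.inl (self_mem_pivotCluster hu _), h⟩

/-- The decisions at `u` follow the labels of the edges that `P` has right, so that with two such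
edges a mistake opposite to `u` closes a `(+, +, -)` triangle. -/
theorem algProb_nonpos {u v w : V} (hv : v ∈ R) (hw : w ∈ R) (huv : u ≠ v)
    (huw : u ≠ w) (hmv : ¬ IsMistake G P u v) (hmw : ¬ IsMistake G P u w)
    (ht : ¬ IsPPMTriangle G u v w) : algProb G P L p R u v w ≤ 0 := by
  refine roundExp_le fun s hs => (ind_false fun h => ?_).le
  have h1 := mt (hs v) hmv
  have h2 := mt (hs w) hmw
  unfold ClusterMistake at h
  rw [mem_pivotCluster hv huv.symm, mem_pivotCluster hw huw.symm] at h
  unfold IsPPMTriangle at ht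
  tauto

/-- If `{u, v}` is the only mistake of `P` on `{u, v, w}`, then the iteration with pivot `u` makes
a mistake on `{v, w}` only if the triangle is a `(+, +, -)` triangle and `{u, v}` is not
discovered. -/
theorem algProb_only {u v w : V} (hP : IsClustering P) (hL : IsTriangleEnum G R u (L u))
    (hv : v ∈ R) (hw : w ∈ R) (huw : u ≠ w) (hvw : v ≠ w)
    (hmv : IsMistake G P u v) (hmw : ¬ IsMistake G P u w) (hm : ¬ IsMistake G P v w) :
    algProb G P L p R u v w ≤ ind (OnlyMistake G P u v w) * missProb G P p R u v := by
  have key : ∀ s : IterState V, (∀ x ∈ s.mistake, IsMistake G P u x) →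
      ClusterMistake G (pivotCluster G R u s.mistake) v w →
      v ∉ s.mistake ∧ OnlyMistake G P u v w := by
    intro s hs h
    have h1 : SameCluster P u v → SameCluster P v w → SameCluster P u w := .trans hP
    have h2 : SameCluster P u v → SameCluster P u w → SameCluster P v w :=
      fun h => h.symm.trans hP
    have h3 : SameCluster P u w → SameCluster P v w → SameCluster P u v :=
      fun h h' => h.trans hP h'.symm
    have h4 := mt (hs w) hmw
    have huv := hmv.1
    unfold ClusterMistake at h
    rw [mem_pivotCluster hv huv.symm, mem_pivotCluster hw huw.symm] at h
    have e1 := (isMistake_iff huv).1 hmv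
    have e2 := (isMistake_iff huw).not.1 hmw
    have e3 := (isMistake_iff hvw).not.1 hm
    have h5 : v ∉ s.mistake := by
      intro h5
      by_cases a1 : G.Adj u v <;> by_cases a2 : G.Adj u w <;> by_cases a3 : G.Adj v w <;>
        simp_all
    refine ⟨h5, ⟨⟨huv, huw, hvw⟩, ?_⟩, hmv, hmw, hm⟩
    by_cases a1 : G.Adj u v <;> by_cases a2 : G.Adj u w <;> by_cases a3 : G.Adj v w <;>
      simp_all
  by_cases ho : OnlyMistake G P u v w
  · rw [ind_true ho, one_mul, ← roundExp_notMem hL hv hmv]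
    exact roundExp_mono fun s hs => ind_mono fun h => (key s hs h).1
  · rw [ind_false ho, zero_mul]
    exact roundExp_le fun s hs => (ind_false fun h => ho (key s hs h).2).le

/-- If `{v, w}` is a `-` edge and `{u, w}` a `+` edge, then the iteration with pivot `u` can put `v`
and `w` into the same cluster only if it misses the mistake `{u, w}`, and if the iteration with
pivot `w` misses it, then `{u, v}` is decided. Both events have the same probability. -/
theorem algProb_le_of_adj {u v w : V} (hLu : IsTriangleEnum G R u (L u))
    (hLw : IsTriangleEnum G R w (L w)) (hu : u ∈ R) (hv : v ∈ R) (hw : w ∈ R)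
    (hmv : IsMistake G P u v) (hmw : IsMistake G P u w) (hvw : ¬ G.Adj v w) (huw : G.Adj u w) :
    algProb G P L p R u v w ≤ optProb G P L p R w v u := by
  have h1 : algProb G P L p R u v w ≤ missProb G P p R u w := by
    rw [← roundExp_notMem hLu hw hmw]
    refine roundExp_mono fun s _ => ind_mono fun h => ?_
    unfold ClusterMistake at h
    rw [mem_pivotCluster hv hmv.1.symm, mem_pivotCluster hw hmw.1.symm] at h
    tauto
  refine h1.trans ?_
  rw [missProb_comm huw, ← roundExp_notMem hLw hu hmw.symm]
  refine roundExp_mono fun s _ => ind_mono fun h => ⟨Or.inr ?_, hmv.symm⟩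
  rw [mem_pivotCluster hu hmw.1]
  exact ⟨fun _ => h, fun _ => huw.symm⟩

/-- If both edges at the pivot are mistakes and the opposite edge is right, then the mistake is paid
for by the other two pivots. For a `+` edge `{v, w}` they always decide these edges; otherwise one of
the edges at `u` is a `+` edge, as `P` separates `v` from `w`. -/
theorem algProb_two {u v w : V} (hP : IsClustering P)
    (hL : ∀ x ∈ R, IsTriangleEnum G R x (L x)) (hu : u ∈ R) (hv : v ∈ R) (hw : w ∈ R)
    (h : TwoMistakes G P u v w) :
    algProb G P L p R u v w ≤ optProb G P L p R v u w + optProb G P L p R w v u := by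
  obtain ⟨hvw, hmv, hmw, hm⟩ := h
  have o1 := optProb_nonneg (G := G) (P := P) (L := L) (p := p) (R := R) v u w
  have o2 := optProb_nonneg (G := G) (P := P) (L := L) (p := p) (R := R) w v u
  by_cases hadj : G.Adj v w
  · have : (1 : ℝ) ≤ optProb G P L p R w v u := by
      refine le_roundExp fun _ hs => ?_
      rw [ind_true]
      refine ⟨Or.inl ?_, hmv.symm⟩
      rw [mem_pivotCluster hv hvw]
      exact ⟨fun _ h => hm (hs v h).symm, fun _ => hadj.symm⟩
    linarith [algProb_le_one (G := G) (P := P) (L := L) (p := p) (R := R) u v w]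
  · by_cases huw : G.Adj u w
    · linarith [algProb_le_of_adj (p := p) (hL u hu) (hL w hw) hu hv hw hmv hmw hadj huw]
    · have huv : G.Adj u v := by
        have : SameCluster P u v → SameCluster P u w → SameCluster P v w :=
          fun h => h.symm.trans hP
        unfold IsMistake at hmv hmw hm
        tauto
      have := algProb_le_of_adj (p := p) (hL u hu) (hL v hv) hu hw hv hmw hmv
        (fun h => hadj h.symm) huv
      rw [algProb_swap, optProb_swap v]
      linarith

end Round

/-! ### Averaging over the pivot -/

section Charging

variable {V : Type*} [DecidableEq V] {G : SimpleGraph V} [DecidableRel G.Adj]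
  {P : Finset (Finset V)} {L : V → List (V × V)} {p : unitInterval} {R : Finset V}

/-- The charging scheme: a mistake on `{v, w}` with pivot `u` is paid for by `P`'s mistake on the
same edge, or by the mistakes opposite to the other two possible pivots, or, if the triangle has
only one mistake, by the edge of that mistake. -/
theorem algProb_le (hP : IsClustering P) (hL : ∀ x ∈ R, IsTriangleEnum G R x (L x))
    {u v w : V} (hu : u ∈ R) (hv : v ∈ R) (hw : w ∈ R) :
    algProb G P L p R u v w ≤
      ind (IsMistake G P v w ∧ u ≠ v ∧ u ≠ w) * optProb G P L p R u v w +
      ind (TwoMistakes G P u v w) * optProb G P L p R v u w +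
      ind (TwoMistakes G P u v w) * optProb G P L p R w v u +
      ind (OnlyMistake G P u v w) * missProb G P p R u v +
      ind (OnlyMistake G P u w v) * missProb G P p R u w +
      ind (v = u) * (ind (IsMistake G P u w) * (1 - missProb G P p R u w)) +
      ind (w = u) * (ind (IsMistake G P u v) * (1 - missProb G P p R u v)) := by
  have i1 := mul_nonneg (ind_nonneg (IsMistake G P v w ∧ u ≠ v ∧ u ≠ w))
    (optProb_nonneg (G := G) (P := P) (L := L) (p := p) (R := R) u v w)
  have i2 := mul_nonneg (ind_nonneg (TwoMistakes G P u v w))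
    (optProb_nonneg (G := G) (P := P) (L := L) (p := p) (R := R) v u w)
  have i3 := mul_nonneg (ind_nonneg (TwoMistakes G P u v w))
    (optProb_nonneg (G := G) (P := P) (L := L) (p := p) (R := R) w v u)
  have i4 := mul_nonneg (ind_nonneg (OnlyMistake G P u v w))
    (missProb_nonneg (G := G) (P := P) (p := p) (R := R) u v)
  have i5 := mul_nonneg (ind_nonneg (OnlyMistake G P u w v))
    (missProb_nonneg (G := G) (P := P) (p := p) (R := R) u w)
  have i6 := mul_nonneg (ind_nonneg (v = u)) (mul_nonneg (ind_nonneg (IsMistake G P u w))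
    (sub_nonneg.2 (missProb_le_one (G := G) (P := P) (p := p) (R := R) u w)))
  have i7 := mul_nonneg (ind_nonneg (w = u)) (mul_nonneg (ind_nonneg (IsMistake G P u v))
    (sub_nonneg.2 (missProb_le_one (G := G) (P := P) (p := p) (R := R) u v)))
  by_cases hvw : v = w
  · subst hvw
    linarith [algProb_self_nonpos (G := G) (P := P) (L := L) (p := p) (R := R) u v]
  by_cases huv : v = u
  · subst huv
    have := algProb_pivot (P := P) (p := p) (hL v hv) hu hw hvw
    rw [ind_true (q := v = v) rfl, one_mul] at i6 ⊢
    linarith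
  by_cases huw : w = u
  · subst huw
    have := algProb_pivot (P := P) (p := p) (hL w hw) hu hv (Ne.symm hvw)
    rw [algProb_swap]
    rw [ind_true (q := w = w) rfl, one_mul] at i7 ⊢
    linarith
  by_cases hm : IsMistake G P v w
  · have := algProb_le_optProb (L := L) (p := p) (R := R) (u := u) hm
    rw [ind_true (q := IsMistake G P v w ∧ u ≠ v ∧ u ≠ w) ⟨hm, Ne.symm huv, Ne.symm huw⟩,
      one_mul] at i1 ⊢
    linarith
  by_cases hmv : IsMistake G P u v <;> by_cases hmw : IsMistake G P u w
  · have h2 : TwoMistakes G P u v w := ⟨hvw, hmv, hmw, hm⟩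
    have := algProb_two (p := p) hP hL hu hv hw h2
    rw [ind_true h2, one_mul] at i2 ⊢
    rw [one_mul] at ⊢
    linarith
  · have := algProb_only (p := p) hP (hL u hu) hv hw (Ne.symm huw) hvw hmv hmw hm
    linarith
  · have := algProb_only (p := p) hP (hL u hu) hw hv (Ne.symm huv) (Ne.symm hvw) hmw hmv
      (fun h => hm h.symm)
    rw [algProb_swap]
    linarith
  · have := algProb_nonpos (L := L) (p := p) (P := P) hv hw (Ne.symm huv) (Ne.symm huw) hmv hmw
      fun h => by have := h.exists_isMistake hP; tauto
    linarith

/-- If `{v, w}` is the only mistake on its triangle, then the pivot `u` decides `{v, w}`. -/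
theorem one_le_optProb {u v w : V} (hv : v ∈ R) (hw : w ∈ R) (h : OnlyMistake G P v w u) :
    1 ≤ optProb G P L p R u v w := by
  obtain ⟨⟨⟨n1, n2, n3⟩, ht⟩, hm, hv', hw'⟩ := h
  refine le_roundExp fun s hs => ?_
  rw [ind_true]
  refine ⟨?_, hm⟩
  rw [mem_pivotCluster hv n2, mem_pivotCluster hw n3, G.adj_comm u v, G.adj_comm u w]
  have h1 := mt (hs v) fun h => hv' h.symm
  have h2 := mt (hs w) fun h => hw' h.symm
  tauto

/-- The pivot decides its own edges, and the mistakes that are alone on a triangle with it. -/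
theorem le_optProb {u v w : V} (hu : u ∈ R) (hv : v ∈ R) (hw : w ∈ R) :
    ind (v = u) * ind (IsMistake G P u w) + ind (w = u) * ind (IsMistake G P u v) +
      ind (OnlyMistake G P v w u) ≤ optProb G P L p R u v w := by
  by_cases huv : v = u
  · subst huv
    have h := optProb_pivot (G := G) (P := P) (L := L) (p := p) hu w
    rw [ind_false (q := OnlyMistake G P v w v) (fun h => h.1.1.2.1 rfl),
      ind_false (q := IsMistake G P v v) (fun h => h.1 rfl), ind_true (q := v = v) rfl]
    linarith
  by_cases huw : w = u
  · subst huw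
    have h := optProb_pivot (G := G) (P := P) (L := L) (p := p) hu v
    rw [ind_false (q := OnlyMistake G P v w w) (fun h => h.1.1.2.2 rfl), ind_false huv,
      ind_true (q := w = w) rfl, optProb_swap]
    linarith
  rw [ind_false huv, ind_false huw]
  by_cases ho : OnlyMistake G P v w u
  · have := one_le_optProb (L := L) (p := p) hv hw ho
    rw [ind_true ho]
    linarith
  · rw [ind_false ho]
    linarith [optProb_nonneg (G := G) (P := P) (L := L) (p := p) (R := R) u v w]

/-- The charges that the mistake `{y, z}` opposite to the pivot `x` receives. -/
theorem charge_le {c : ℝ} (hc : 2 ≤ c) {x y z : V} (hx : x ∈ R) (hy : y ∈ R) (hz : z ∈ R) :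
    ind (IsMistake G P y z ∧ x ≠ y ∧ x ≠ z) * optProb G P L p R x y z +
      ind (TwoMistakes G P y x z) * optProb G P L p R x y z +
      ind (TwoMistakes G P z y x) * optProb G P L p R x y z +
      (c - 1) * ind (OnlyMistake G P y z x) +
      ind (y = x) * (c * ind (IsMistake G P x z)) +
      ind (z = x) * (c * ind (IsMistake G P x y)) ≤ c * optProb G P L p R x y z := by
  have h0 := optProb_nonneg (G := G) (P := P) (L := L) (p := p) (R := R) x y z
  have hc0 : 0 ≤ (c - 2) * optProb G P L p R x y z := mul_nonneg (by linarith) h0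
  by_cases hxy : y = x
  · subst hxy
    have h1 : ¬ TwoMistakes G P y y z := fun h => h.2.1.1 rfl
    have h2 : ¬ TwoMistakes G P z y y := fun h => h.1 rfl
    have h3 : ¬ OnlyMistake G P y z y := fun h => h.1.1.2.1 rfl
    have h4 := optProb_pivot (G := G) (P := P) (L := L) (p := p) hy z
    have h6 : ind (z = y) * (c * ind (IsMistake G P y y)) = 0 := by
      rw [ind_false (q := IsMistake G P y y) (fun h => h.1 rfl), mul_zero, mul_zero]
    rw [ind_false h1, ind_false h2, ind_false h3, h6, ind_true (q := y = y) rfl,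
      ind_false (q := IsMistake G P y z ∧ y ≠ y ∧ y ≠ z) (by tauto)]
    have := mul_le_mul_of_nonneg_left h4 (by linarith : 0 ≤ c)
    linarith
  by_cases hxz : z = x
  · subst hxz
    have h1 : ¬ TwoMistakes G P y z z := fun h => h.1 rfl
    have h2 : ¬ TwoMistakes G P z y z := fun h => h.2.2.1.1 rfl
    have h3 : ¬ OnlyMistake G P y z z := fun h => h.1.1.2.2 rfl
    have h4 := optProb_pivot (G := G) (P := P) (L := L) (p := p) hz y
    rw [optProb_swap] at h4
    rw [ind_false h1, ind_false h2, ind_false h3, ind_true (q := z = z) rfl,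
      ind_false (q := y = z) hxy,
      ind_false (q := IsMistake G P y z ∧ z ≠ y ∧ z ≠ z) (by tauto)]
    have := mul_le_mul_of_nonneg_left h4 (by linarith : 0 ≤ c)
    linarith
  rw [ind_false hxy, ind_false hxz]
  by_cases ho : OnlyMistake G P y z x
  · have h1 : ¬ TwoMistakes G P y x z := fun h => ho.2.2.1 h.2.1
    have h2 : ¬ TwoMistakes G P z y x := fun h => ho.2.2.2 h.2.2.1
    rw [ind_false h1, ind_false h2, ind_true ho, ind_true ⟨ho.2.1, Ne.symm hxy, Ne.symm hxz⟩]
    have := mul_le_mul_of_nonneg_left (one_le_optProb (L := L) (p := p) hy hz ho)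
      (by linarith : 0 ≤ c - 1)
    linarith
  · rw [ind_false ho]
    have h1 := mul_le_of_le_one_left h0 (ind_le_one (IsMistake G P y z ∧ x ≠ y ∧ x ≠ z))
    have h2 : ind (TwoMistakes G P y x z) + ind (TwoMistakes G P z y x) ≤ 1 := by
      by_cases h : TwoMistakes G P y x z
      · rw [ind_false (q := TwoMistakes G P z y x) fun h' => h'.2.2.2 h.2.1]
        linarith [ind_le_one (TwoMistakes G P y x z)]
      · rw [ind_false h]
        linarith [ind_le_one (TwoMistakes G P z y x)]
    have h3 := mul_le_of_le_one_left h0 h2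
    linarith

/-- The inequality behind the constant `3 / (1 + 2 * p)`, with `q = 1 - p`. It rests on
`q ^ 2 * (3 - 2 * q) ≤ 1` for `n ≥ 3`, and needs only `2 ≤ c` for `n ≤ 2`. -/
theorem pow_mul_le {c q : ℝ} (hc : 2 ≤ c) (hq0 : 0 ≤ q) (hq1 : q ≤ 1) (hcq : 3 ≤ c * (3 - 2 * q))
    (n : ℕ) : 2 * q ^ n * (n - 1) ≤ (c - 1) * (n + 2) := by
  rcases n with _ | _ | _ | n
  · norm_num; linarith
  · norm_num; linarith
  · have : q ^ 2 ≤ 1 := pow_le_one₀ hq0 hq1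
    norm_num
    linarith
  · have h1 : q ^ (n + 3) ≤ q ^ 3 := pow_le_pow_of_le_one hq0 hq1 (by omega)
    have h2 : q ^ 2 * (3 - 2 * q) ≤ 1 := by
      nlinarith [mul_nonneg (sq_nonneg (1 - q)) (by linarith : 0 ≤ 1 + 2 * q)]
    have h3 : 2 * q ^ 3 ≤ c - 1 := by
      have h4 : 2 * q ^ 3 * (3 - 2 * q) ≤ (c - 1) * (3 - 2 * q) := by nlinarith
      exact le_of_mul_le_mul_right h4 (by linarith)
    have hn : (0 : ℝ) ≤ n := n.cast_nonneg
    push_cast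
    have h5 := mul_le_mul_of_nonneg_right (h1.trans (by linarith : q ^ 3 ≤ (c - 1) / 2))
      (by linarith : (0 : ℝ) ≤ n + 2)
    nlinarith

/-- The charges that a mistake `{v, w}` receives from pivots at its ends. If it is the only mistake
on `n` triangles, then these pivots miss it with probability at most `(1 - p) ^ n`. -/
theorem edge_charge_le {c : ℝ} (hc : 2 ≤ c) (hcp : 3 ≤ c * (1 + 2 * p)) (v w : V) :
    2 * missProb G P p R v w * ∑ x ∈ R, ind (OnlyMistake G P v w x) +
      2 * (ind (IsMistake G P v w) * (1 - missProb G P p R v w)) ≤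
    (c - 1) * ∑ x ∈ R, ind (OnlyMistake G P v w x) + 2 * c * ind (IsMistake G P v w) := by
  classical
  by_cases hm : IsMistake G P v w
  · rw [ind_true hm, sum_ind]
    set n := (R.filter fun x => OnlyMistake G P v w x).card with hn
    have hp0 := p.2.1
    have hp1 := p.2.2
    have hle : n ≤ askCount G P R v w := by
      refine Finset.card_le_card fun x => ?_
      simp only [Finset.mem_filter]
      exact fun ⟨hx, h⟩ => ⟨hx, h.1, Or.inr h.2.2.1⟩
    have h1 : missProb G P p R v w ≤ (1 - (p : ℝ)) ^ n :=
      pow_le_pow_of_le_one (by linarith) (by linarith) hle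
    have h2 := pow_mul_le hc (q := 1 - p) (by linarith) (by linarith) (by linarith) n
    have h0 := missProb_nonneg (G := G) (P := P) (p := p) (R := R) v w
    -- For `n = 0` the factor `n - 1` is negative, and the bound on `missProb` cannot be used.
    rcases Nat.eq_zero_or_pos n with h | h
    · rw [h]
      push_cast
      linarith
    · have h3 : (1 : ℝ) ≤ n := by exact_mod_cast h
      have := mul_le_mul_of_nonneg_right h1 (by linarith : (0 : ℝ) ≤ n - 1)
      linarith
  · rw [ind_false hm]
    have : ∀ x, ¬ OnlyMistake G P v w x := fun x h => hm h.2.1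
    simp [ind, this]

theorem sum_sum_sum_reverse {α : Type*} (R : Finset α) (φ : α → α → α → ℝ) :
    ∑ u ∈ R, ∑ v ∈ R, ∑ w ∈ R, φ u v w = ∑ u ∈ R, ∑ v ∈ R, ∑ w ∈ R, φ w v u := by
  have h : ∀ ψ : α → α → α → ℝ,
      ∑ u ∈ R, ∑ v ∈ R, ∑ w ∈ R, ψ u v w = ∑ u ∈ R, ∑ v ∈ R, ∑ w ∈ R, ψ u w v :=
    fun ψ => Finset.sum_congr rfl fun u _ => Finset.sum_comm
  rw [Finset.sum_comm, h, Finset.sum_comm]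

theorem sum_sum_sum_rotate {α : Type*} (R : Finset α) (φ : α → α → α → ℝ) :
    ∑ u ∈ R, ∑ v ∈ R, ∑ w ∈ R, φ v w u = ∑ u ∈ R, ∑ v ∈ R, ∑ w ∈ R, φ u v w := by
  rw [Finset.sum_comm]
  exact Finset.sum_congr rfl fun u _ => Finset.sum_comm

theorem sum_ind_eq_mul {α : Type*} {R : Finset α} {u : α} (hu : u ∈ R) (a : ℝ) :
    ∑ v ∈ R, ind (v = u) * a = a := by
  classical
  simp [ind, hu]

theorem sum_pivot_left {α : Type*} (R : Finset α) (φ : α → α → ℝ) :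
    ∑ u ∈ R, ∑ v ∈ R, ∑ w ∈ R, ind (v = u) * φ u w = ∑ u ∈ R, ∑ w ∈ R, φ u w :=
  Finset.sum_congr rfl fun u hu => by
    rw [Finset.sum_comm]
    exact Finset.sum_congr rfl fun w _ => sum_ind_eq_mul hu _

theorem sum_pivot_right {α : Type*} (R : Finset α) (φ : α → α → ℝ) :
    ∑ u ∈ R, ∑ v ∈ R, ∑ w ∈ R, ind (w = u) * φ u v = ∑ u ∈ R, ∑ v ∈ R, φ u v :=
  Finset.sum_congr rfl fun _ hu => Finset.sum_congr rfl fun _ _ => sum_ind_eq_mul hu _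

/-- With a random pivot, the expected number of mistakes made in an iteration is at most `c` times
the expected number of decided mistakes of `P`. Both sides count ordered pairs. -/
theorem sum_algProb_le {c : ℝ} (hc : 2 ≤ c) (hcp : 3 ≤ c * (1 + 2 * p)) (hP : IsClustering P)
    (hL : ∀ x ∈ R, IsTriangleEnum G R x (L x)) :
    ∑ u ∈ R, ∑ v ∈ R, ∑ w ∈ R, algProb G P L p R u v w ≤
      c * ∑ u ∈ R, ∑ v ∈ R, ∑ w ∈ R, optProb G P L p R u v w := by
  have h1 := Finset.sum_le_sum fun u hu => Finset.sum_le_sum fun v hv =>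
    Finset.sum_le_sum fun w hw => algProb_le (p := p) hP hL (u := u) (v := v) (w := w) hu hv hw
  have h2 := Finset.sum_le_sum fun u (hu : u ∈ R) => Finset.sum_le_sum fun v (hv : v ∈ R) =>
    Finset.sum_le_sum fun w (hw : w ∈ R) =>
      charge_le (G := G) (P := P) (L := L) (p := p) hc (x := u) (y := v) (z := w) hu hv hw
  have h3 := Finset.sum_le_sum fun v (_ : v ∈ R) => Finset.sum_le_sum fun w (_ : w ∈ R) =>
    edge_charge_le (G := G) (P := P) (R := R) (p := p) hc hcp v w
  simp only [Finset.sum_add_distrib] at h1 h2 h3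
  -- The sums are renamed so that the charged pivot becomes the first summation variable.
  have r1 : ∑ u ∈ R, ∑ v ∈ R, ∑ w ∈ R,
        ind (TwoMistakes G P u v w) * optProb G P L p R v u w =
      ∑ u ∈ R, ∑ v ∈ R, ∑ w ∈ R, ind (TwoMistakes G P v u w) * optProb G P L p R u v w :=
    Finset.sum_comm
  have r2 : ∑ u ∈ R, ∑ v ∈ R, ∑ w ∈ R,
        ind (TwoMistakes G P u v w) * optProb G P L p R w v u =
      ∑ u ∈ R, ∑ v ∈ R, ∑ w ∈ R, ind (TwoMistakes G P w v u) * optProb G P L p R u v w :=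
    sum_sum_sum_reverse R fun u v w => ind (TwoMistakes G P u v w) * optProb G P L p R w v u
  have r3 : ∑ u ∈ R, ∑ v ∈ R, ∑ w ∈ R, ind (OnlyMistake G P u w v) * missProb G P p R u w =
      ∑ u ∈ R, ∑ v ∈ R, ∑ w ∈ R, ind (OnlyMistake G P u v w) * missProb G P p R u v :=
    Finset.sum_congr rfl fun u _ => Finset.sum_comm
  have r4 : ∑ u ∈ R, ∑ v ∈ R, ∑ w ∈ R, (c - 1) * ind (OnlyMistake G P v w u) =
      ∑ u ∈ R, ∑ v ∈ R, (c - 1) * ∑ w ∈ R, ind (OnlyMistake G P u v w) := by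
    simp only [Finset.mul_sum]
    exact sum_sum_sum_rotate R fun u v w => (c - 1) * ind (OnlyMistake G P u v w)
  have r5 : ∑ u ∈ R, ∑ v ∈ R, 2 * missProb G P p R u v * ∑ w ∈ R, ind (OnlyMistake G P u v w) =
      2 * ∑ u ∈ R, ∑ v ∈ R, ∑ w ∈ R, ind (OnlyMistake G P u v w) * missProb G P p R u v := by
    simp only [Finset.mul_sum]
    refine Finset.sum_congr rfl fun u _ => Finset.sum_congr rfl fun v _ =>
      Finset.sum_congr rfl fun w _ => by ring
  have d3 := sum_pivot_left R fun u w => ind (IsMistake G P u w) * (1 - missProb G P p R u w)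
  have d4 := sum_pivot_right R fun u w => ind (IsMistake G P u w) * (1 - missProb G P p R u w)
  have d5 := sum_pivot_left R fun u w => c * ind (IsMistake G P u w)
  have d6 := sum_pivot_right R fun u w => c * ind (IsMistake G P u w)
  have r6 : ∑ u ∈ R, ∑ v ∈ R, 2 * (ind (IsMistake G P u v) * (1 - missProb G P p R u v)) =
      2 * ∑ u ∈ R, ∑ v ∈ R, ind (IsMistake G P u v) * (1 - missProb G P p R u v) := by
    simp only [Finset.mul_sum]
  have r7 : ∑ u ∈ R, ∑ v ∈ R, 2 * c * ind (IsMistake G P u v) =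
      2 * ∑ u ∈ R, ∑ v ∈ R, c * ind (IsMistake G P u v) := by
    simp only [Finset.mul_sum, mul_assoc]
  have r8 : c * ∑ u ∈ R, ∑ v ∈ R, ∑ w ∈ R, optProb G P L p R u v w =
      ∑ u ∈ R, ∑ v ∈ R, ∑ w ∈ R, c * optProb G P L p R u v w := by
    simp only [Finset.mul_sum]
  rw [r1, r2, r3, d3, d4] at h1
  rw [r4, d5, d6] at h2
  rw [r5, r6, r7] at h3
  rw [r8]
  linarith

/-! ### The queries of one iteration -/

/-- With a random pivot, the expected number of queries in an iteration is at most `c / 2` times the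
expected number of decided mistakes of `P`, counted as ordered pairs. The queries of mistakes are
paid for by the decided mistakes at the pivot. Every other query is made in a triangle with one
mistake of `P`, and its probability is at most `p` for each such triangle. -/
theorem sum_queried_le {c : ℝ} (hc : 1 ≤ c) (hcp : 4 * (p : ℝ) ≤ c) (hP : IsClustering P)
    (hL : ∀ x ∈ R, IsTriangleEnum G R x (L x)) :
    2 * ∑ u ∈ R, ∑ v ∈ R, roundExp G P L p u (fun s => ind (v ∈ s.queried)) ≤
      c * ∑ u ∈ R, ∑ v ∈ R, ∑ w ∈ R, optProb G P L p R u v w := by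
  classical
  have hp := p.2.1
  have h1 : ∀ u ∈ R, ∀ v ∈ R, roundExp G P L p u (fun s => ind (v ∈ s.queried)) ≤
      ind (IsMistake G P u v) +
        p * ∑ w ∈ R, (ind (OnlyMistake G P u w v) + ind (OnlyMistake G P v w u)) := by
    intro u hu v hv
    by_cases hm : IsMistake G P u v
    · rw [ind_true hm]
      have h1 : roundExp G P L p u (fun s => ind (v ∈ s.queried)) ≤ 1 :=
        roundExp_le fun _ _ => ind_le_one _
      have h2 : 0 ≤ p * ∑ w ∈ R, (ind (OnlyMistake G P u w v) + ind (OnlyMistake G P v w u)) :=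
        mul_nonneg hp (Finset.sum_nonneg fun w _ => add_nonneg (ind_nonneg _) (ind_nonneg _))
      linarith
    · refine (loopExp_mem_queried_le v (consistent_empty u)).trans ?_
      rw [countP_asks (hL u hu) hv, ind_false (by simp), ind_false hm, zero_add, zero_add, askCount,
        ← sum_ind]
      refine mul_le_mul_of_nonneg_left (Finset.sum_le_sum fun w _ => ?_) hp
      by_cases h : IsPPMTriangle G u v w ∧ (G.Adj u v ∨ ¬ IsMistake G P u w)
      · rw [ind_true h]
        rcases OnlyMistake.of_asks hP h.1 h.2 hm with h' | h'
        · rw [ind_true h']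
          linarith [ind_nonneg (OnlyMistake G P v w u)]
        · rw [ind_true h']
          linarith [ind_nonneg (OnlyMistake G P u w v)]
      · rw [ind_false h]
        exact add_nonneg (ind_nonneg _) (ind_nonneg _)
  have h2 := Finset.sum_le_sum fun u hu => Finset.sum_le_sum fun v hv => h1 u hu v hv
  have h3 := Finset.sum_le_sum fun u (hu : u ∈ R) => Finset.sum_le_sum fun v (hv : v ∈ R) =>
    Finset.sum_le_sum fun w (hw : w ∈ R) =>
      le_optProb (G := G) (P := P) (L := L) (p := p) (u := u) (v := v) (w := w) hu hv hw
  simp only [Finset.sum_add_distrib] at h3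
  rw [sum_pivot_left R fun u w => ind (IsMistake G P u w),
    sum_pivot_right R fun u w => ind (IsMistake G P u w),
    sum_sum_sum_rotate R fun u v w => ind (OnlyMistake G P u v w)] at h3
  have r1 : ∑ u ∈ R, ∑ v ∈ R, (ind (IsMistake G P u v) +
        p * ∑ w ∈ R, (ind (OnlyMistake G P u w v) + ind (OnlyMistake G P v w u))) =
      ∑ u ∈ R, ∑ v ∈ R, ind (IsMistake G P u v) +
        2 * p * ∑ u ∈ R, ∑ v ∈ R, ∑ w ∈ R, ind (OnlyMistake G P u v w) := by
    have e1 : ∑ u ∈ R, ∑ v ∈ R, ∑ w ∈ R, ind (OnlyMistake G P u w v) =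
        ∑ u ∈ R, ∑ v ∈ R, ∑ w ∈ R, ind (OnlyMistake G P u v w) :=
      Finset.sum_congr rfl fun u _ => Finset.sum_comm
    have e2 := sum_sum_sum_rotate R fun u v w => ind (OnlyMistake G P u v w)
    simp only [Finset.sum_add_distrib, ← Finset.mul_sum]
    rw [e1, e2]
    ring
  rw [r1] at h2
  have hM : 0 ≤ ∑ u ∈ R, ∑ v ∈ R, ind (IsMistake G P u v) :=
    Finset.sum_nonneg fun u _ => Finset.sum_nonneg fun v _ => ind_nonneg _
  have hJ : 0 ≤ ∑ u ∈ R, ∑ v ∈ R, ∑ w ∈ R, ind (OnlyMistake G P u v w) :=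
    Finset.sum_nonneg fun u _ => Finset.sum_nonneg fun v _ => Finset.sum_nonneg fun w _ =>
      ind_nonneg _
  have k1 := mul_le_mul_of_nonneg_left h3 (by linarith : 0 ≤ c)
  have k2 := mul_le_mul_of_nonneg_right hc hM
  have k3 := mul_le_mul_of_nonneg_right hcp hJ
  linarith

/-- All queries of an iteration go to remaining vertices. -/
theorem roundExp_card_queried_le [Fintype V] {u : V} (hL : IsTriangleEnum G R u (L u)) :
    roundExp G P L p u (fun s => (s.queried.card : ℝ)) ≤
      ∑ v ∈ R, roundExp G P L p u (fun s => ind (v ∈ s.queried)) := by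
  classical
  have h1 : (fun s : IterState V => (s.queried.card : ℝ)) =
      fun s => ∑ v, ind (v ∈ s.queried) := by
    funext s
    rw [sum_ind, Finset.filter_mem_eq_inter, Finset.univ_inter]
  rw [h1, roundExp, loopExp_sum, ← Finset.sum_add_sum_compl R]
  refine add_le_of_nonpos_right (Finset.sum_nonpos fun v hv => ?_)
  refine (loopExp_mem_queried_le v (consistent_empty u)).trans ?_
  rw [List.countP_eq_zero.2, ind_false (by simp)]
  · simp
  · intro t ht
    obtain ⟨h2, h3, -⟩ := hL.1 t ht
    rw [Finset.mem_compl] at hv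
    rw [decide_eq_true_eq]
    rintro (rfl | ⟨rfl, -⟩)
    · exact hv h2
    · exact hv h3

end Charging

/-! ### The output of the algorithm -/

section Output

variable {V : Type*}

/-- `P` is a partition of the set `R` into nonempty clusters. -/
def IsClusteringOf (R : Finset V) (P : Finset (Finset V)) : Prop :=
  ∅ ∉ P ∧ (∀ C ∈ P, C ⊆ R) ∧ ∀ v ∈ R, ∃! C : Finset V, C ∈ P ∧ v ∈ C

/-- The number of ordered pairs of vertices in `R` on which `P` makes a mistake. -/
noncomputable def mistakesOn (G : SimpleGraph V) (P : Finset (Finset V)) (R : Finset V) : ℝ :=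
  ∑ v ∈ R, ∑ w ∈ R, ind (IsMistake G P v w)

theorem mistakesOn_nonneg (G : SimpleGraph V) (P : Finset (Finset V)) (R : Finset V) :
    0 ≤ mistakesOn G P R :=
  Finset.sum_nonneg fun _ _ => Finset.sum_nonneg fun _ _ => ind_nonneg _

theorem two_mul_mistakes [Fintype V] [DecidableEq V] (G : SimpleGraph V) [DecidableRel G.Adj]
    (P : Finset (Finset V)) : 2 * (mistakes G P : ℝ) = mistakesOn G P Finset.univ := by
  classical
  let H : SimpleGraph V := ⟨IsMistake G P, ⟨fun _ _ h => IsMistake.symm h⟩, ⟨fun _ h => h.1 rfl⟩⟩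
  have h1 : mistakes G P = H.edgeFinset.card := by
    unfold mistakes
    congr 1
    ext e
    induction e with
    | h a b =>
      simp only [Finset.mem_filter, Finset.mem_univ, true_and, SimpleGraph.mem_edgeFinset,
        SimpleGraph.mem_edgeSet]
      constructor
      · rintro ⟨u, v, h, hm⟩
        rcases Sym2.eq_iff.1 h with ⟨rfl, rfl⟩ | ⟨rfl, rfl⟩
        · exact hm
        · exact hm.symm
      · exact fun h => ⟨a, b, rfl, h⟩
  have h2 := H.sum_degrees_eq_twice_card_edges
  rw [h1]
  have h3 : ((2 * H.edgeFinset.card : ℕ) : ℝ) = mistakesOn G P Finset.univ := by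
    rw [← h2, mistakesOn]
    push_cast
    refine Finset.sum_congr rfl fun v _ => ?_
    rw [sum_ind, ← SimpleGraph.card_neighborFinset_eq_degree]
    congr 2
    ext w
    simp [H]
  rw [← h3]
  push_cast
  ring

variable [DecidableEq V]

theorem sum_sdiff_sdiff (R C : Finset V) (φ : V → V → ℝ) :
    ∑ v ∈ R \ C, ∑ w ∈ R \ C, φ v w =
      ∑ v ∈ R, ∑ w ∈ R, if v ∉ C ∧ w ∉ C then φ v w else 0 := by
  simp only [Finset.sdiff_eq_filter, Finset.sum_filter]
  refine Finset.sum_congr rfl fun v _ => ?_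
  by_cases hv : v ∈ C <;> simp [hv]

variable {G : SimpleGraph V} {P : Finset (Finset V)} {R C : Finset V}

/-- The mistakes of `P` in `R` are those decided by removing `C` and those that remain. -/
theorem mistakesOn_eq_add : mistakesOn G P R =
    ∑ v ∈ R, ∑ w ∈ R, ind (DecidedMistake G P C v w) + mistakesOn G P (R \ C) := by
  simp only [mistakesOn, sum_sdiff_sdiff, ← Finset.sum_add_distrib]
  refine Finset.sum_congr rfl fun v _ => Finset.sum_congr rfl fun w _ => ?_
  by_cases h : v ∉ C ∧ w ∉ C
  · rw [if_pos h, ind_false (q := DecidedMistake G P C v w) (by unfold DecidedMistake; tauto),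
      zero_add]
  · rw [if_neg h, add_zero]
    exact ind_congr (by unfold DecidedMistake; tauto)

/-- The output makes a mistake when its first cluster `C` is removed, or later. -/
theorem mistakesOn_insert_le (hP : IsClusteringOf (R \ C) P) : mistakesOn G (insert C P) R ≤
    ∑ v ∈ R, ∑ w ∈ R, ind (ClusterMistake G C v w) + mistakesOn G P (R \ C) := by
  simp only [mistakesOn, sum_sdiff_sdiff, ← Finset.sum_add_distrib]
  refine Finset.sum_le_sum fun v _ => Finset.sum_le_sum fun w _ => ?_
  have h1 : SameCluster (insert C P) v w ↔ (v ∈ C ∧ w ∈ C) ∨ SameCluster P v w := by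
    simp [SameCluster]
  by_cases h : v ∉ C ∧ w ∉ C
  · have h2 : ind (IsMistake G (insert C P) v w) = ind (IsMistake G P v w) :=
      ind_congr (by unfold IsMistake; rw [h1]; tauto)
    rw [if_pos h, h2]
    linarith [ind_nonneg (ClusterMistake G C v w)]
  · rw [if_neg h, add_zero]
    refine ind_mono fun hm => ?_
    have h2 : ¬ SameCluster P v w := by
      rintro ⟨D, hD, hv, hw⟩
      have hv' := (Finset.mem_sdiff.1 (hP.2.1 D hD hv)).2
      have hw' := (Finset.mem_sdiff.1 (hP.2.1 D hD hw)).2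
      exact h ⟨hv', hw'⟩
    unfold IsMistake at hm
    rw [h1] at hm
    unfold ClusterMistake
    tauto

theorem IsClusteringOf.insert (hC : C ⊆ R) (hne : C.Nonempty) (hP : IsClusteringOf (R \ C) P) :
    IsClusteringOf R (insert C P) := by
  obtain ⟨h0, hsub, huniq⟩ := hP
  refine ⟨?_, ?_, fun v hv => ?_⟩
  · simp only [Finset.mem_insert, not_or]
    exact ⟨hne.ne_empty.symm, h0⟩
  · intro D hD
    rcases Finset.mem_insert.1 hD with rfl | hD
    · exact hC
    · exact (hsub D hD).trans Finset.sdiff_subset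
  · by_cases hvC : v ∈ C
    · refine ⟨C, ⟨Finset.mem_insert_self _ _, hvC⟩, fun D ⟨hD, hvD⟩ => ?_⟩
      rcases Finset.mem_insert.1 hD with rfl | hD
      · rfl
      · exact absurd hvC (Finset.mem_sdiff.1 (hsub D hD hvD)).2
    · obtain ⟨D, ⟨hD, hvD⟩, hun⟩ := huniq v (Finset.mem_sdiff.2 ⟨hv, hvC⟩)
      refine ⟨D, ⟨Finset.mem_insert_of_mem hD, hvD⟩, fun E ⟨hE, hvE⟩ => ?_⟩
      rcases Finset.mem_insert.1 hE with rfl | hE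
      · exact absurd hvE hvC
      · exact hun E ⟨hE, hvE⟩

end Output

/-! ### Induction over the iterations -/

section Induction

variable {V : Type*} [DecidableEq V] {G : SimpleGraph V} [DecidableRel G.Adj]
  {T : Finset V → V → List (V × V)} {p : unitInterval}

theorem pivotCluster_subset (R : Finset V) (u : V) (M : Finset V) : pivotCluster G R u M ⊆ R :=
  Finset.filter_subset _ _

theorem sdiff_pivotCluster_ssubset {R : Finset V} {u : V} (hu : u ∈ R) (M : Finset V) :
    R \ pivotCluster G R u M ⊂ R :=
  Finset.sdiff_ssubset (pivotCluster_subset R u M) ⟨u, self_mem_pivotCluster hu M⟩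

theorem isClusteringOf_of_mem_support {oracle : V → V → Bool} (R : Finset V) :
    ∀ out ∈ (randomQueryPivot G T oracle p R).support, IsClusteringOf R out.1 := by
  induction R using Finset.strongInduction with
  | H R ih =>
    intro out hout
    rw [randomQueryPivot] at hout
    split_ifs at hout with h
    · simp only [PMF.mem_support_bind_iff, PMF.mem_support_map_iff] at hout
      obtain ⟨⟨u, hu⟩, -, s, -, out', hout', rfl⟩ := hout
      exact (ih _ (sdiff_pivotCluster_ssubset hu _) out' hout').insert
        (pivotCluster_subset R u _) ⟨u, self_mem_pivotCluster hu _⟩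
    · rw [Finset.not_nonempty_iff_eq_empty] at h
      simp only [PMF.support_pure, Set.mem_singleton_iff] at hout
      subst hout h
      exact ⟨by simp, by simp, by simp⟩

/-- If in every iteration the expected cost is at most `c` times the expected number of decided
mistakes of `P`, then the expected total cost is at most `c` times the number of mistakes of `P`,
because every pair is decided once. Pairs are ordered. -/
theorem mean_randomQueryPivot_le {P : Finset (Finset V)} {c : ℝ}
    (Ψ : Finset V → Finset (Finset V) × Finset (Sym2 V) → ℝ)
    (cost : Finset V → V → IterState V → ℝ) (hcost : ∀ R u s, 0 ≤ cost R u s) (hc : 0 ≤ c)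
    (h0 : Ψ ∅ (∅, ∅) ≤ 0)
    (hstep : ∀ R, ∀ u ∈ R, ∀ s out,
      IsClusteringOf (R \ pivotCluster G R u s.mistake) out.1 →
      Ψ R (insert (pivotCluster G R u s.mistake) out.1,
          (s.queried.image fun v => s(u, v)) ∪ out.2) ≤
        cost R u s + Ψ (R \ pivotCluster G R u s.mistake) out)
    (hround : ∀ R, ∑ u ∈ R, roundExp G P (T R) p u (cost R u) ≤
      c * ∑ u ∈ R, ∑ v ∈ R, ∑ w ∈ R, optProb G P (T R) p R u v w) (R : Finset V) :
    mean (randomQueryPivot G T (oracleOf G P) p R) (fun out => ENNReal.ofReal (Ψ R out)) ≤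
      ENNReal.ofReal (c * mistakesOn G P R) := by
  induction R using Finset.strongInduction with
  | H R ih =>
    rw [randomQueryPivot]
    split_ifs with h
    · have hne : Nonempty R := h.to_subtype
      have key : ∀ u ∈ R, mean ((triangleLoop G (oracleOf G P) p u (T R u) ⟨∅, ∅⟩).bind fun s =>
          (randomQueryPivot G T (oracleOf G P) p (R \ pivotCluster G R u s.mistake)).map
            fun out => (insert (pivotCluster G R u s.mistake) out.1,
              (s.queried.image fun v => s(u, v)) ∪ out.2))
          (fun out => ENNReal.ofReal (Ψ R out)) ≤
          ENNReal.ofReal (roundExp G P (T R) p u fun s => cost R u s +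
            c * mistakesOn G P (R \ pivotCluster G R u s.mistake)) := by
        intro u hu
        rw [mean_bind, roundExp, ← mean_triangleLoop fun s => add_nonneg (hcost R u s)
          (mul_nonneg hc (mistakesOn_nonneg G P _))]
        refine mean_mono fun s _ => ?_
        rw [mean_map, ENNReal.ofReal_add (hcost R u s) (mul_nonneg hc (mistakesOn_nonneg G P _))]
        refine le_trans ?_ (add_le_add_right (ih _ (sdiff_pivotCluster_ssubset hu s.mistake)) _)
        rw [← mean_const_add]
        refine mean_mono fun out hout => ?_
        exact (ENNReal.ofReal_le_ofReal (hstep R u hu s out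
          (isClusteringOf_of_mem_support _ out hout))).trans ENNReal.ofReal_add_le
      rw [mean_bind]
      refine (mean_mono fun u _ => key u.1 u.2).trans ?_
      rw [mean_uniformOfFintype R fun u => ENNReal.ofReal (roundExp G P (T R) p u fun s =>
        cost R u s + c * mistakesOn G P (R \ pivotCluster G R u s.mistake)),
        ← ENNReal.ofReal_sum_of_nonneg fun u _ => roundExp_nonneg fun s => add_nonneg (hcost R u s)
          (mul_nonneg hc (mistakesOn_nonneg G P _))]
      -- The mistakes of `P` in `R` are decided in this iteration or remain for the next ones.
      have h1 : ∀ u, c * mistakesOn G P R =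
          c * ∑ v ∈ R, ∑ w ∈ R, optProb G P (T R) p R u v w + c * roundExp G P (T R) p u fun s =>
            mistakesOn G P (R \ pivotCluster G R u s.mistake) := by
        intro u
        rw [← mul_add]
        congr 1
        simp only [optProb, roundExp, ← loopExp_sum, ← loopExp_add, ← mistakesOn_eq_add,
          loopExp_const]
      have h2 : ∑ u ∈ R, (roundExp G P (T R) p u fun s =>
          cost R u s + c * mistakesOn G P (R \ pivotCluster G R u s.mistake)) ≤
          R.card * (c * mistakesOn G P R) := by
        rw [← nsmul_eq_mul, ← Finset.sum_const, Finset.sum_congr rfl fun u _ => h1 u]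
        have h3 := hround R
        simp only [roundExp, loopExp_add, loopExp_const_mul, Finset.sum_add_distrib] at h3 ⊢
        rw [Finset.mul_sum] at h3
        linarith
      refine (mul_le_mul_right (ENNReal.ofReal_le_ofReal h2) _).trans_eq ?_
      rw [ENNReal.ofReal_mul (Nat.cast_nonneg _), ENNReal.ofReal_natCast, ← mul_assoc,
        ENNReal.inv_mul_cancel (by simpa using h.ne_empty) (ENNReal.natCast_ne_top _), one_mul]
    · rw [Finset.not_nonempty_iff_eq_empty] at h
      subst h
      rw [mean_pure, ENNReal.ofReal_eq_zero.2 h0]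
      exact zero_le

end Induction

end CorrelationClustering

open CorrelationClustering in
theorem theorem2 {V : Type*} [Fintype V] [DecidableEq V]
    (G : SimpleGraph V) [DecidableRel G.Adj]
    (OPT : Finset (Finset V)) (hOPT : CorrelationClustering.IsOptimal G OPT)
    (T : Finset V → V → List (V × V))
    (hT : ∀ (R : Finset V) (u : V), u ∈ R →
      CorrelationClustering.IsTriangleEnum G R u (T R u))
    (p : unitInterval) :
    (∀ out ∈ (CorrelationClustering.randomQueryPivot G T
          (CorrelationClustering.oracleOf G OPT) p Finset.univ).support,
        CorrelationClustering.IsClustering out.1) ∧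
    CorrelationClustering.expectation
        (CorrelationClustering.randomQueryPivot G T
          (CorrelationClustering.oracleOf G OPT) p Finset.univ)
        (fun out => CorrelationClustering.mistakes G out.1) ≤
      ENNReal.ofReal (max 2 (3 / (1 + 2 * (p : ℝ)))) *
        (CorrelationClustering.mistakes G OPT : ENNReal) ∧
    CorrelationClustering.expectation
        (CorrelationClustering.randomQueryPivot G T
          (CorrelationClustering.oracleOf G OPT) p Finset.univ)
        (fun out => out.2.card) ≤
      ENNReal.ofReal (max (4 * (p : ℝ)) 1) *
        (CorrelationClustering.mistakes G OPT : ENNReal) := by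
  have hp := p.2.1
  have hP := hOPT.1
  refine ⟨fun out hout => ?_, ?_, ?_⟩
  · obtain ⟨h0, -, h⟩ := isClusteringOf_of_mem_support _ out hout
    exact ⟨h0, fun v => h v (Finset.mem_univ v)⟩
  · set c := max 2 (3 / (1 + 2 * (p : ℝ))) with hc
    have hc2 : 2 ≤ c := le_max_left _ _
    have hcp : 3 ≤ c * (1 + 2 * p) := by
      rw [← div_le_iff₀ (by linarith)]
      exact le_max_right _ _
    -- `mistakesOn` counts ordered pairs, hence the factor `1 / 2`.
    have h := mean_randomQueryPivot_le (G := G) (T := T) (p := p) (P := OPT) (c := c / 2)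
      (fun R out => 1 / 2 * mistakesOn G out.1 R)
      (fun R u s => 1 / 2 * ∑ v ∈ R, ∑ w ∈ R,
        ind (ClusterMistake G (pivotCluster G R u s.mistake) v w))
      (fun R u s => mul_nonneg (by norm_num) (Finset.sum_nonneg fun _ _ =>
        Finset.sum_nonneg fun _ _ => ind_nonneg _))
      (by linarith) (by simp [mistakesOn])
      (fun R u _ s out hout => by
        have := mistakesOn_insert_le (G := G) hout
        dsimp only
        linarith)
      (fun R => by
        have := sum_algProb_le (p := p) hc2 hcp hP (hT R)
        simp only [roundExp, loopExp_const_mul, loopExp_sum, ← Finset.mul_sum]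
        simp only [algProb, roundExp] at this
        linarith) Finset.univ
    rw [← two_mul_mistakes, show c / 2 * (2 * (mistakes G OPT : ℝ)) = c * mistakes G OPT by ring,
      ENNReal.ofReal_mul (by linarith), ENNReal.ofReal_natCast] at h
    rw [expectation_eq_mean]
    refine le_of_eq_of_le ?_ h
    congr 1
    funext out
    rw [← two_mul_mistakes, ← mul_assoc, one_div_mul_cancel two_ne_zero, one_mul,
      ENNReal.ofReal_natCast]
  · set c := max (4 * (p : ℝ)) 1 with hc
    have hc1 : 1 ≤ c := le_max_right _ _
    have hcp : 4 * p ≤ c := le_max_left _ _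
    have h := mean_randomQueryPivot_le (G := G) (T := T) (p := p) (P := OPT) (c := c / 2)
      (fun _ out => out.2.card) (fun _ _ s => s.queried.card) (fun _ _ _ => Nat.cast_nonneg _)
      (by linarith) (by simp)
      (fun R u _ s out _ => by
        have h1 := Finset.card_union_le (s.queried.image fun v => s(u, v)) out.2
        have h2 := Finset.card_image_le (s := s.queried) (f := fun v => s(u, v))
        exact_mod_cast h1.trans (Nat.add_le_add_right h2 _))
      (fun R => by
        have h1 := sum_queried_le (p := p) hc1 hcp hP (hT R)
        have h2 := Finset.sum_le_sum fun u hu =>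
          roundExp_card_queried_le (G := G) (P := OPT) (p := p) (hT R u hu)
        linarith) Finset.univ
    rw [← two_mul_mistakes, show c / 2 * (2 * (mistakes G OPT : ℝ)) = c * mistakes G OPT by ring,
      ENNReal.ofReal_mul (by linarith), ENNReal.ofReal_natCast] at h
    rw [expectation_eq_mean]
    simpa only [ENNReal.ofReal_natCast] using h
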